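/- Let $B$ be a real Banach space. For a nonempty set $A\subset B$ write $\operatorname{dist}(x,A)=\inf_{a\in A}\|x-a\|$. For $\alpha\ge 0$, a nonempty closed set $P\subset B$ is called $\alpha$-paraconvex if for every open ball $D\subset B$ of radius $r>0$ and every $q\in\operatorname{conv}(P\cap D)$ one has $\operatorname{dist}(q,P)\le\alpha r$. Let $\mathrm{bexp}_\alpha(B)$ be the family of all bounded $\alpha$-paraconvex subsets of $B$, endowed with the Hausdorff metric, and let $C_b(B,B)$ be the Banach space of all bounded continuous mappings of $B$ into itself with the supremum norm. For a nonempty bounded set $A\subset B$ let $URetr(A)\subset C_b(B,B)$ be the set of all continuous retractions $R$ of $B$ onto $A$ (that is, $R(x)\in A$ for all $x\in B$ and $R(x)=x$ for all $x\in A$) which are uniform with respect to $A$: for every $\varepsilon>0$ there is $\delta>0$ such that for all $x\in B$, $\operatorname{dist}(x,A)<\delta$ implies $\|x-R(x)\|<\varepsilon$. **Proposition 2.4.** For every $0\le\alpha<\frac12$ the multivalued mapping $P\mapsto URetr(P)$ on $\mathrm{bexp}_\alpha(B)$ admits a continuous single-valued selection, i.e. there is a continuous mapping $\mathfrak R:\mathrm{bexp}_\alpha(B)\to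 C_b(B,B)$, $P\mapsto\mathfrak R_P$, with $\mathfrak R_P\in URetr(P)$ for every $P\in\mathrm{bexp}_\alpha(B)$. -/

import Mathlib

open Set Metric Bornology
open scoped BoundedContinuousFunction

/-- A nonempty closed subset `P` of a normed space is `α`-paraconvex if for every open ball
`D` of radius `r > 0` every point `q` of `conv (P ∩ D)` satisfies `dist (q, P) ≤ α * r`. -/
structure IsParaconvex {B : Type*} [NormedAddCommGroup B] [NormedSpace ℝ B]
    (α : ℝ) (P : Set B) : Prop where
  nonempty : P.Nonempty
  isClosed : IsClosed P
  infDist_le : ∀ (c : B) (r : ℝ), 0 < r →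
    ∀ q ∈ convexHull ℝ (P ∩ ball c r), infDist q P ≤ α * r

/-- The family of all bounded `α`-paraconvex subsets of `B`. -/
@[ext]
structure BExp (α : ℝ) (B : Type*) [NormedAddCommGroup B] [NormedSpace ℝ B] where
  carrier : Set B
  isBounded : IsBounded carrier
  isParaconvex : IsParaconvex α carrier

theorem BExp.hausdorffEDist_ne_top {α : ℝ} {B : Type*} [NormedAddCommGroup B] [NormedSpace ℝ B]
    (P Q : BExp α B) : hausdorffEDist P.carrier Q.carrier ≠ ⊤ :=
  hausdorffEDist_ne_top_of_nonempty_of_bounded P.isParaconvex.nonempty Q.isParaconvex.nonempty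
    P.isBounded Q.isBounded

/-- The family of bounded `α`-paraconvex subsets is endowed with the Hausdorff metric. -/
noncomputable instance BExp.instMetricSpace {α : ℝ} {B : Type*} [NormedAddCommGroup B]
    [NormedSpace ℝ B] : MetricSpace (BExp α B) where
  dist P Q := hausdorffDist P.carrier Q.carrier
  dist_self _ := hausdorffDist_self_zero
  dist_comm _ _ := hausdorffDist_comm
  dist_triangle P Q _ := hausdorffDist_triangle (P.hausdorffEDist_ne_top Q)
  eq_of_dist_eq_zero {P Q} h := BExp.ext
    ((P.isParaconvex.isClosed.hausdorffDist_zero_iff_eq Q.isParaconvex.isClosed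
      (P.hausdorffEDist_ne_top Q)).1 h)

/-- `R : B → B` is a continuous retraction of `B` onto `A` which is uniform with respect
to `A`. (This is not uniform continuity of `R`.) -/
structure IsUniformRetraction {B : Type*} [NormedAddCommGroup B] (A : Set B) (R : B → B) :
    Prop where
  continuous : Continuous R
  mem : ∀ x, R x ∈ A
  eq_self : ∀ x ∈ A, R x = x
  uniform : ∀ ε > 0, ∃ δ > 0, ∀ x, infDist x A < δ → dist x (R x) < ε

/-- The set of all uniform retractions of `B` onto `A`, as a subset of the space of bounded
continuous mappings of `B` into itself with the supremum norm (if `A` is bounded, every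
retraction onto `A` is bounded). -/
def URetr {B : Type*} [NormedAddCommGroup B] (A : Set B) : Set (B →ᵇ B) :=
  {R | IsUniformRetraction A R}

/-! Michael's selection theorem extends from convex to paraconvex values: convex-valued approximate
selections can be corrected with errors shrinking like `β ^ n`. It is used twice. For the constant
value `P` on `Pᶜ` it yields a retraction `S` with `dist x (S x) ≤ 2 * infDist x P`; then `S ∘ Q`
corrects a near-retraction `Q` at twice its distance from `P`. This makes `P ↦ URetr P` lower
semicontinuous with `2 * α`-paraconvex values, and as `2 * α < 1` the theorem applies again, over
the metric space `BExp α B`. -/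

open Filter Topology

/-! ### Selections of paraconvex-valued mappings -/

/-- One step of Michael's iteration: a continuous `f` at distance less than `r` from the
paraconvex values of a lower semicontinuous mapping `F` can be moved by less than `r` so as to
be at distance less than `β * r` from them. -/
theorem exists_continuous_infDist_lt {X E : Type*} [TopologicalSpace X] [NormalSpace X]
    [ParacompactSpace X] [NormedAddCommGroup E] [NormedSpace ℝ E] {F : X → Set E} {α β : ℝ}
    (hαβ : α < β) (hF : ∀ x, IsParaconvex α (F x))
    (hlsc : ∀ x, ∀ y ∈ F x, ∀ ε > 0, ∀ᶠ x' in 𝓝 x, infDist y (F x') < ε)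
    {f : X → E} (hf : Continuous f) {r : X → ℝ} (hr : Continuous r) (hr0 : ∀ x, 0 < r x)
    (h : ∀ x, infDist (f x) (F x) < r x) :
    ∃ g : X → E, Continuous g ∧ ∀ x, dist (f x) (g x) < r x ∧ infDist (g x) (F x) < β * r x := by
  -- Paraconvexity puts the thickened hull within `α * r + (β - α) * r` of `F x`; the thickening
  -- lets a point of `F x` stay in `t y` for `y` near `x`.
  let t : X → Set E := fun x ↦ ball (f x) (r x) ∩
    thickening ((β - α) * r x) (convexHull ℝ (F x ∩ ball (f x) (r x)))
  have ht : ∀ x, Convex ℝ (t x) := fun x ↦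
    (convex_ball _ _).inter ((convex_convexHull ℝ _).thickening _)
  have hloc : ∀ x, ∃ c : E, ∀ᶠ y in 𝓝 x, c ∈ t y := by
    intro x
    obtain ⟨c, hcF, hc⟩ := (infDist_lt_iff (hF x).nonempty).1 (h x)
    have hβ : 0 < (β - α) * r x := mul_pos (sub_pos.2 hαβ) (hr0 x)
    obtain ⟨ε, hε, hε'⟩ := exists_between (lt_min hβ (sub_pos.2 hc))
    rw [lt_min_iff] at hε'
    have h1 : ∀ᶠ y in 𝓝 x, ε < (β - α) * r y :=
      (continuous_const.mul hr).continuousAt.eventually_const_lt hε'.1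
    have h2 : ∀ᶠ y in 𝓝 x, ε < r y - dist (f y) c :=
      (hr.sub (hf.dist continuous_const)).continuousAt.eventually_const_lt hε'.2
    refine ⟨c, ?_⟩
    filter_upwards [h1, h2, hlsc x c hcF ε hε] with y hy1 hy2 hy3
    obtain ⟨z, hzF, hz⟩ := (infDist_lt_iff (hF y).nonempty).1 hy3
    refine ⟨?_, mem_thickening_iff.2 ⟨z, subset_convexHull ℝ _ ⟨hzF, ?_⟩, hz.trans hy1⟩⟩
    · rw [mem_ball']
      linarith
    · rw [mem_ball']
      linarith [dist_triangle (f y) c z]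
  obtain ⟨g, hg⟩ := exists_continuous_forall_mem_convex_of_local_const ht hloc
  refine ⟨g, g.continuous, fun x ↦ ⟨mem_ball'.1 (hg x).1, ?_⟩⟩
  obtain ⟨z, hz, hgz⟩ := mem_thickening_iff.1 (hg x).2
  have := (hF x).infDist_le (f x) (r x) (hr0 x) z hz
  linarith [infDist_le_infDist_add_dist (s := F x) (x := g x) (y := z)]

/-- Michael's selection theorem for paraconvex-valued mappings. -/
theorem exists_continuous_selection_of_isParaconvex {X E : Type*} [TopologicalSpace X]
    [NormalSpace X] [ParacompactSpace X] [NormedAddCommGroup E] [NormedSpace ℝ E]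
    [CompleteSpace E] {F : X → Set E} {α β : ℝ} (hαβ : α < β) (hβ0 : 0 < β) (hβ1 : β < 1)
    (hF : ∀ x, IsParaconvex α (F x))
    (hlsc : ∀ x, ∀ y ∈ F x, ∀ ε > 0, ∀ᶠ x' in 𝓝 x, infDist y (F x') < ε)
    {f : X → E} (hf : Continuous f) {r : X → ℝ} (hr : Continuous r) (hr0 : ∀ x, 0 < r x)
    (h : ∀ x, infDist (f x) (F x) < r x) :
    ∃ g : X → E, Continuous g ∧ ∀ x, g x ∈ F x ∧ dist (f x) (g x) ≤ r x / (1 - β) := by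
  have step : ∀ (n : ℕ) (u : {u : X → E // Continuous u ∧ ∀ x, infDist (u x) (F x) < r x * β ^ n}),
      ∃ v : {v : X → E // Continuous v ∧ ∀ x, infDist (v x) (F x) < r x * β ^ (n + 1)},
        ∀ x, dist (u.1 x) (v.1 x) ≤ r x * β ^ n := by
    intro n u
    obtain ⟨g, hg, hgx⟩ := exists_continuous_infDist_lt (r := fun x ↦ r x * β ^ n)
      hαβ hF hlsc u.2.1 (hr.mul continuous_const) (fun x ↦ mul_pos (hr0 x) (pow_pos hβ0 n)) u.2.2
    exact ⟨⟨g, hg, fun x ↦ (hgx x).2.trans_eq (by ring)⟩, fun x ↦ (hgx x).1.le⟩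
  choose s hs using step
  let u : ∀ n : ℕ, {u : X → E // Continuous u ∧ ∀ x, infDist (u x) (F x) < r x * β ^ n} :=
    fun n ↦ Nat.rec ⟨f, hf, by simpa using h⟩ s n
  have hu : ∀ x n, dist ((u n).1 x) ((u (n + 1)).1 x) ≤ r x * β ^ n := fun x n ↦ hs n (u n) x
  have hlim : ∀ x, ∃ y, Tendsto (fun n ↦ (u n).1 x) atTop (𝓝 y) := fun x ↦
    cauchySeq_tendsto_of_complete (cauchySeq_of_le_geometric β (r x) hβ1 (hu x))
  choose g hg using hlim
  have hdist : ∀ x n, dist ((u n).1 x) (g x) ≤ r x * β ^ n / (1 - β) := fun x n ↦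
    dist_le_of_le_geometric_of_tendsto β (r x) hβ1 (hu x) (hg x) n
  have hpow : Tendsto (fun n : ℕ ↦ β ^ n) atTop (𝓝 0) :=
    tendsto_pow_atTop_nhds_zero_of_lt_one hβ0.le hβ1
  refine ⟨g, ?_, fun x ↦ ⟨?_, (hdist x 0).trans_eq (by simp)⟩⟩
  · have hunif : TendstoLocallyUniformly (fun n ↦ (u n).1) g atTop := by
      rw [Metric.tendstoLocallyUniformly_iff]
      intro ε hε x
      -- `r` may be unbounded, so the convergence is only locally uniform.
      refine ⟨{y | r y < r x + 1}, hr.continuousAt.eventually_lt_const (lt_add_one _), ?_⟩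
      have hlt : ∀ᶠ n : ℕ in atTop, (r x + 1) * β ^ n / (1 - β) < ε := by
        have := (hpow.const_mul (r x + 1)).div_const (1 - β)
        rw [mul_zero, zero_div] at this
        exact this.eventually_lt_const hε
      filter_upwards [hlt] with n hn y hy
      rw [dist_comm]
      refine (hdist y n).trans_lt (lt_of_le_of_lt ?_ hn)
      have : 0 < 1 - β := sub_pos.2 hβ1
      have hy' : r y ≤ r x + 1 := le_of_lt hy
      gcongr
    exact hunif.continuous (Frequently.of_forall fun n ↦ (u n).2.1)
  · rw [(hF x).isClosed.mem_iff_infDist_zero (hF x).nonempty]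
    have h1 : Tendsto (fun n ↦ infDist ((u n).1 x) (F x)) atTop (𝓝 (infDist (g x) (F x))) :=
      ((continuous_infDist_pt (F x)).tendsto _).comp (hg x)
    have h2 : Tendsto (fun n : ℕ ↦ r x * β ^ n) atTop (𝓝 0) := by
      simpa using hpow.const_mul (r x)
    exact le_antisymm (le_of_tendsto_of_tendsto' h1 h2 fun n ↦ ((u n).2.2 x).le) infDist_nonneg

/-! ### Retractions onto a paraconvex set -/

/-- A continuous retraction onto a paraconvex set which moves points comparably to their
distance from the set. -/
theorem IsParaconvex.exists_retraction {B : Type*} [NormedAddCommGroup B] [NormedSpace ℝ B]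
    [CompleteSpace B] {α : ℝ} (hα₀ : 0 ≤ α) (hα : α < 1 / 2) {P : Set B}
    (hP : IsParaconvex α P) :
    ∃ R : B → B, Continuous R ∧ ∀ x, R x ∈ P ∧ dist x (R x) ≤ 2 * infDist x P := by
  classical
  obtain ⟨β, hαβ, hβ⟩ := exists_between hα
  have hpos : ∀ x : ↥Pᶜ, 0 < infDist (x : B) P := fun x ↦
    (hP.isClosed.notMem_iff_infDist_pos hP.nonempty).1 x.2
  -- As `β < 1 / 2`, the radius `2 * (1 - β) * infDist x P` exceeds the distance to `P`; division by
  -- `1 - β` leaves the factor 2.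
  have hc : 1 < 2 * (1 - β) := by linarith
  obtain ⟨g, hg, hgx⟩ := exists_continuous_selection_of_isParaconvex (X := ↥Pᶜ)
    (F := fun _ ↦ P) (f := fun x ↦ (x : B)) (r := fun x ↦ 2 * (1 - β) * infDist (x : B) P)
    hαβ (hα₀.trans_lt hαβ) (by linarith) (fun _ ↦ hP)
    (fun x y hy ε hε ↦ Eventually.of_forall fun _ ↦ by rwa [infDist_zero_of_mem hy])
    continuous_subtype_val
    (continuous_const.mul ((continuous_infDist_pt P).comp continuous_subtype_val))
    (fun x ↦ mul_pos (by linarith) (hpos x)) (fun x ↦ lt_mul_of_one_lt_left (hpos x) hc)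
  let R : B → B := fun x ↦ if hx : x ∈ P then x else g ⟨x, hx⟩
  have hR : ∀ x, R x ∈ P ∧ dist x (R x) ≤ 2 * infDist x P := by
    intro x
    by_cases hx : x ∈ P
    · simp [R, hx, infDist_nonneg]
    · have := hgx ⟨x, hx⟩
      simp only [R, hx, dite_false]
      refine ⟨this.1, this.2.trans_eq ?_⟩
      have : 1 - β ≠ 0 := by linarith
      field_simp
  refine ⟨R, continuous_iff_continuousAt.2 fun x ↦ ?_, hR⟩
  by_cases hx : x ∈ P
  · have hRx : R x = x := by simp [R, hx]
    rw [ContinuousAt, hRx, tendsto_iff_dist_tendsto_zero]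
    have h0 : Tendsto (fun y ↦ 2 * infDist y P + dist y x) (𝓝 x) (𝓝 0) := by
      have : Continuous fun y ↦ 2 * infDist y P + dist y x :=
        (continuous_const.mul (continuous_infDist_pt P)).add (continuous_id.dist continuous_const)
      simpa [infDist_zero_of_mem hx] using this.tendsto x
    refine squeeze_zero (fun _ ↦ dist_nonneg) (fun y ↦ ?_) h0
    linarith [dist_triangle_left (R y) x y, (hR y).2]
  · have : ContinuousOn R Pᶜ := by
      rw [continuousOn_iff_continuous_domRestrict]
      convert hg using 1
      ext y
      exact dif_neg y.2
    exact this.continuousAt (hP.isClosed.isOpen_compl.mem_nhds hx)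

/-! ### Paraconvexity of `URetr P` -/

/-- `Q` is the identity on `A`, uniformly near `A`. -/
def IsUniformNear {B : Type*} [NormedAddCommGroup B] (A : Set B) (Q : B → B) : Prop :=
  ∀ ε > 0, ∃ δ > 0, ∀ x, infDist x A < δ → dist x (Q x) < ε

theorem IsUniformNear.eq_self {B : Type*} [NormedAddCommGroup B] {A : Set B} {Q : B → B}
    (hQ : IsUniformNear A Q) {x : B} (hx : x ∈ A) : Q x = x := by
  refine (eq_of_forall_dist_le fun ε hε ↦ ?_).symm
  obtain ⟨δ, hδ, h⟩ := hQ ε hε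
  exact (h x (by rwa [infDist_zero_of_mem hx])).le

theorem convex_setOf_isUniformNear {B : Type*} [NormedAddCommGroup B] [NormedSpace ℝ B]
    (A : Set B) : Convex ℝ {Q : B →ᵇ B | IsUniformNear A Q} := by
  intro Q hQ R hR a b ha hb hab ε hε
  obtain ⟨δ, hδ, h⟩ := hQ ε hε
  obtain ⟨δ', hδ', h'⟩ := hR ε hε
  refine ⟨min δ δ', lt_min hδ hδ', fun x hx ↦ ?_⟩
  rw [lt_min_iff] at hx
  have hx1 := h x hx.1
  have hx2 := h' x hx.2
  rw [← mem_ball'] at hx1 hx2 ⊢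
  exact convex_ball x ε hx1 hx2 ha hb hab

/-- A bounded mapping which is uniformly near the identity on a bounded paraconvex set `P` and
has values within `d` of `P` is within `2 * d` of a uniform retraction onto `P`. -/
theorem IsParaconvex.exists_mem_uRetr_dist_le {B : Type*} [NormedAddCommGroup B]
    [NormedSpace ℝ B] [CompleteSpace B] {α : ℝ} (hα₀ : 0 ≤ α) (hα : α < 1 / 2) {P : Set B}
    (hP : IsParaconvex α P) (hb : IsBounded P) {Q : B → B} (hQc : Continuous Q)
    (hQ : IsUniformNear P Q) {d : ℝ} (hd : ∀ x, infDist (Q x) P ≤ d) :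
    ∃ R ∈ URetr P, ∀ x, dist (Q x) (R x) ≤ 2 * d := by
  obtain ⟨S, hS, hSx⟩ := hP.exists_retraction hα₀ hα
  obtain ⟨C, hC⟩ := isBounded_iff.1 hb
  let R : B →ᵇ B := BoundedContinuousFunction.mkOfBound ⟨S ∘ Q, hS.comp hQc⟩ C
    fun x y ↦ hC (hSx _).1 (hSx _).1
  have hRQ : ∀ x, dist (Q x) (R x) ≤ 2 * infDist (Q x) P := fun x ↦ (hSx (Q x)).2
  have hR : IsUniformNear P R := by
    intro ε hε
    -- `Q x` is within `ε / 3` of `P`, so the total move is below `ε / 6 + 2 * (ε / 3)`.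
    obtain ⟨δ, hδ, h⟩ := hQ (ε / 6) (by positivity)
    refine ⟨min δ (ε / 6), lt_min hδ (by positivity), fun x hx ↦ ?_⟩
    rw [lt_min_iff] at hx
    have h1 := h x hx.1
    have h2 := infDist_le_infDist_add_dist (s := P) (x := Q x) (y := x)
    rw [dist_comm] at h2
    linarith [hRQ x, dist_triangle x (Q x) (R x)]
  exact ⟨R, ⟨R.continuous, fun x ↦ (hSx _).1, fun x hx ↦ hR.eq_self hx, hR⟩,
    fun x ↦ (hRQ x).trans (by linarith [hd x])⟩

theorem isClosed_uRetr {B : Type*} [NormedAddCommGroup B] {P : Set B} (hP : IsClosed P) :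
    IsClosed (URetr P) := by
  refine isClosed_of_closure_subset fun R hR ↦ ?_
  rw [Metric.mem_closure_iff] at hR
  have hu : IsUniformNear P R := by
    intro ε hε
    obtain ⟨S, hS, hRS⟩ := hR (ε / 2) (half_pos hε)
    obtain ⟨δ, hδ, h⟩ := hS.uniform (ε / 2) (half_pos hε)
    refine ⟨δ, hδ, fun x hx ↦ ?_⟩
    have h1 := BoundedContinuousFunction.dist_coe_le_dist (f := R) (g := S) x
    linarith [h x hx, dist_triangle_right x (R x) (S x)]
  refine ⟨R.continuous, fun x ↦ ?_, fun x hx ↦ hu.eq_self hx, hu⟩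
  rw [← hP.closure_eq, Metric.mem_closure_iff]
  intro ε hε
  obtain ⟨S, hS, hRS⟩ := hR ε hε
  exact ⟨S x, hS.mem x, (BoundedContinuousFunction.dist_coe_le_dist x).trans_lt hRS⟩

/-- Convex combinations of retractions near `h` stay uniformly near the identity at `P`, and
pointwise lie in `convexHull ℝ (P ∩ ball (h x) r)`, within `α * r` of `P`; the correction doubles
this. -/
theorem IsParaconvex.isParaconvex_uRetr {B : Type*} [NormedAddCommGroup B]
    [NormedSpace ℝ B] [CompleteSpace B] {α : ℝ} (hα₀ : 0 ≤ α) (hα : α < 1 / 2) {P : Set B}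
    (hP : IsParaconvex α P) (hb : IsBounded P) : IsParaconvex (2 * α) (URetr P) where
  nonempty := by
    obtain ⟨S, hS, hSx⟩ := hP.exists_retraction hα₀ hα
    obtain ⟨R, hR, -⟩ := hP.exists_mem_uRetr_dist_le hα₀ hα hb hS
      (fun ε hε ↦ ⟨ε / 2, half_pos hε, fun x hx ↦ by linarith [(hSx x).2]⟩)
      (d := 0) (fun x ↦ (infDist_zero_of_mem (hSx x).1).le)
    exact ⟨R, hR⟩
  isClosed := isClosed_uRetr hP.isClosed
  infDist_le := by
    intro h r hr Q hQ
    have hsub : URetr P ∩ ball h r ⊆ {Q : B →ᵇ B | IsUniformNear P Q} ∩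
        {Q | ∀ x, Q x ∈ convexHull ℝ (P ∩ ball (h x) r)} := fun R hR ↦
      ⟨hR.1.uniform, fun x ↦ subset_convexHull ℝ _ ⟨hR.1.mem x,
        (BoundedContinuousFunction.dist_coe_le_dist x).trans_lt hR.2⟩⟩
    have hconv : Convex ℝ {Q : B →ᵇ B | ∀ x, Q x ∈ convexHull ℝ (P ∩ ball (h x) r)} :=
      fun Q hQ R hR a b ha hb hab x ↦ convex_convexHull ℝ _ (hQ x) (hR x) ha hb hab
    obtain ⟨hQ1, hQ2⟩ := convexHull_min hsub ((convex_setOf_isUniformNear P).inter hconv) hQ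
    obtain ⟨R, hR, hQR⟩ := hP.exists_mem_uRetr_dist_le hα₀ hα hb Q.continuous hQ1
      fun x ↦ hP.infDist_le (h x) r hr (Q x) (hQ2 x)
    refine (infDist_le_dist_of_mem hR).trans ?_
    rw [mul_assoc]
    exact (BoundedContinuousFunction.dist_le (by positivity)).2 hQR

/-! ### Lower semicontinuity and the selection -/

/-- Lower semicontinuity of `P ↦ URetr P`. -/
theorem eventually_infDist_uRetr_lt {B : Type*} [NormedAddCommGroup B] [NormedSpace ℝ B]
    [CompleteSpace B] {α : ℝ} (hα₀ : 0 ≤ α) (hα : α < 1 / 2) (P : BExp α B) {R : B →ᵇ B}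
    (hR : R ∈ URetr P.carrier) {ε : ℝ} (hε : 0 < ε) :
    ∀ᶠ P' : BExp α B in 𝓝 P, infDist R (URetr P'.carrier) < ε := by
  obtain ⟨δ₀, hδ₀, hRδ⟩ := hR.uniform (ε / 8) (by positivity)
  obtain ⟨δ, hδ, hδ'⟩ := exists_between (lt_min (half_pos hδ₀) (show 0 < ε / 8 by positivity))
  rw [lt_min_iff] at hδ'
  filter_upwards [ball_mem_nhds P hδ] with P' hP'
  have hdist : hausdorffDist P.carrier P'.carrier < δ := mem_ball'.1 hP'
  -- `Q` passes from the identity on `P'` to `R` at distance `δ`. In between, points are within `2 *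
  -- δ < δ₀` of `P`, where `R` hardly moves them, so `Q` stays close to `R`.
  let φ : B → ℝ := fun x ↦ min 1 (infDist x P'.carrier / δ)
  have hφ0 : ∀ x, 0 ≤ φ x := fun x ↦ le_min zero_le_one (div_nonneg infDist_nonneg hδ.le)
  have hφ1 : ∀ x, φ x ≤ 1 := fun x ↦ min_le_left _ _
  have hφc : Continuous φ :=
    continuous_const.min ((continuous_infDist_pt _).div_const _)
  let Q : B → B := fun x ↦ x + φ x • (R x - x)
  have hQc : Continuous Q := continuous_id.add (hφc.smul (R.continuous.sub continuous_id))
  have hnear : ∀ x, infDist x P'.carrier < δ → dist x (R x) < ε / 8 := by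
    intro x hx
    refine hRδ x ?_
    have := infDist_le_infDist_add_hausdorffDist (x := x) (P'.hausdorffEDist_ne_top P)
    rw [hausdorffDist_comm] at this
    linarith
  have hxQ : ∀ x, dist x (Q x) = φ x * dist x (R x) := by
    intro x
    simp [Q, dist_eq_norm, norm_smul, abs_of_nonneg (hφ0 x), norm_sub_rev x (R x)]
  have hQR : ∀ x, dist (Q x) (R x) ≤ ε / 8 := by
    intro x
    rcases lt_or_ge (infDist x P'.carrier) δ with hx | hx
    · have : Q x - R x = (1 - φ x) • (x - R x) := by
        simp only [Q]
        module
      rw [dist_eq_norm, this, norm_smul, Real.norm_of_nonneg (by linarith [hφ1 x]),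
        ← dist_eq_norm]
      exact (mul_le_of_le_one_left dist_nonneg (by linarith [hφ0 x])).trans (hnear x hx).le
    · have : φ x = 1 := min_eq_left ((one_le_div hδ).2 hx)
      simp only [Q, this, one_smul, add_sub_cancel, dist_self]
      positivity
  have hQu : IsUniformNear P'.carrier Q := by
    intro η hη
    refine ⟨min δ (δ * η / (ε / 8)), lt_min hδ (by positivity), fun x hx ↦ ?_⟩
    rw [lt_min_iff] at hx
    have h1 := hnear x hx.1
    have h2 : φ x < η / (ε / 8) := by
      refine (min_le_right _ _).trans_lt ((div_lt_iff₀ hδ).2 (hx.2.trans_eq ?_))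
      ring
    rw [hxQ]
    calc φ x * dist x (R x) ≤ φ x * (ε / 8) := mul_le_mul_of_nonneg_left h1.le (hφ0 x)
      _ < η := (lt_div_iff₀ (by positivity)).1 h2
  have hd : ∀ x, infDist (Q x) P'.carrier ≤ ε / 4 := by
    intro x
    have h1 := infDist_le_infDist_add_dist (s := P'.carrier) (x := Q x) (y := R x)
    have h2 := infDist_le_hausdorffDist_of_mem (hR.mem x) (P.hausdorffEDist_ne_top P')
    linarith [hQR x]
  obtain ⟨S, hS, hQS⟩ := P'.isParaconvex.exists_mem_uRetr_dist_le hα₀ hα P'.isBounded hQc hQu hd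
  -- `5 / 8 = 1 / 8 + 2 * (1 / 4)`, from `hQR` and `hQS`.
  refine (infDist_le_dist_of_mem hS).trans_lt (lt_of_le_of_lt
    ((BoundedContinuousFunction.dist_le (C := 5 / 8 * ε) (by positivity)).2 fun x ↦ ?_)
    (by linarith))
  linarith [hQR x, hQS x, dist_triangle_left (R x) (S x) (Q x)]

theorem proposition2p4 {B : Type*} [NormedAddCommGroup B] [NormedSpace ℝ B] [CompleteSpace B]
    (α : ℝ) (hα₀ : 0 ≤ α) (hα : α < 1 / 2) :
    ∃ R : BExp α B → (B →ᵇ B),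
      Continuous R ∧ ∀ P : BExp α B, R P ∈ URetr P.carrier := by
  rcases isEmpty_or_nonempty (BExp α B) with _ | ⟨⟨P₀⟩⟩
  · exact ⟨isEmptyElim, continuous_of_const fun P ↦ isEmptyElim P, isEmptyElim⟩
  obtain ⟨C, hC0, hC⟩ := P₀.isBounded.exists_pos_norm_le
  have hpc : ∀ P : BExp α B, IsParaconvex (2 * α) (URetr P.carrier) := fun P ↦
    P.isParaconvex.isParaconvex_uRetr hα₀ hα P.isBounded
  obtain ⟨β, hαβ, hβ⟩ := exists_between (show 2 * α < 1 by linarith)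
  -- The iteration starts at `0`, so a bound on the retractions continuous in `P` is needed;
  -- comparison with `P₀` gives one.
  have hdist : ∀ P : BExp α B, infDist 0 (URetr P.carrier) < dist P P₀ + C + 2 := by
    intro P
    obtain ⟨S, hS⟩ := (hpc P).nonempty
    refine (infDist_le_dist_of_mem hS).trans_lt (lt_of_le_of_lt
      ((BoundedContinuousFunction.dist_le (C := dist P P₀ + C + 1) (by positivity)).2
        fun x ↦ ?_) (by linarith))
    obtain ⟨p, hp, hSp⟩ := exists_dist_lt_of_hausdorffDist_lt (hS.mem x)
      (show hausdorffDist P.carrier P₀.carrier < dist P P₀ + 1 from lt_add_one _)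
      (P.hausdorffEDist_ne_top P₀)
    have h1 := dist_triangle (0 : B) p (S x)
    rw [dist_zero_left p, dist_comm p] at h1
    change dist (0 : B) (S x) ≤ _
    linarith [hC p hp]
  obtain ⟨R, hR, hRP⟩ := exists_continuous_selection_of_isParaconvex
    (F := fun P : BExp α B ↦ URetr P.carrier) (f := fun _ ↦ 0)
    (r := fun P ↦ dist P P₀ + C + 2) hαβ (by linarith) hβ hpc
    (fun P R hR ε hε ↦ eventually_infDist_uRetr_lt hα₀ hα P hR hε)
    continuous_const (by fun_prop) (fun P ↦ by positivity) hdist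
  exact ⟨R, hR, fun P ↦ (hRP P).1⟩
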